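/- Let $M=(M,\in^M)$ be a model of $\mathsf{ZFA}$, that is, of $\mathsf{ZFC}$ with the Axiom of Foundation replaced by the Anti-Foundation Axiom (every flat system of equations has a unique solution). A \emph{graph} is a set with a symmetric binary relation, which need not be irreflexive. Let $M_1$ be the double-membership graph (D-graph) of $M$: its vertices are the elements of $M$, and $x,y\in M$ (possibly equal) are adjacent if and only if $M\models x\in y$ and $M\models y\in x$. A \emph{graph in the sense of $M$} is a graph whose vertex set is $\{x\in M: M\models x\in d\}$ for some $d\in M$ and whose edge relation is $\{(x,y): M\models (x,y)\in r\}$ for some $r\in M$ which $M$ believes to be a set of Kuratowski pairs of elements of $d$. Connected components (with the induced edge relation) and isomorphisms are understood in the metatheory; in particular, paths have (standard) finite length and isomorphisms need not belong to $M$. Then, up to isomorphism, the connected components of $M_1$ are exactly the connected components of graphs in the sense of $M$: every connected component of $M_1$ is isomorphic to a connected component of some graph in the sense of $M$, and every connected component of a graph in the sense of $M$ is isomorphic to a connected component of $M_1$. Moreover, for every connected component $C$ of $M_1$, infinitely many connected components of $M_1$ are isomorphic to $C$. -/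

import Mathlib

/-- A graph: a vertex type with one symmetric binary relation, which need not be irreflexive. -/
structure LoopyGraph (V : Type*) where
  Adj : V → V → Prop
  symm : ∀ x y, Adj x y → Adj y x

namespace LoopyGraph

/-- The induced graph on a set of vertices. -/
def induce {V : Type*} (G : LoopyGraph V) (C : Set V) : LoopyGraph C where
  Adj x y := G.Adj x y
  symm x y h := G.symm x y h

/-- Isomorphism of graphs. -/
def IsIso {V W : Type*} (G : LoopyGraph V) (H : LoopyGraph W) : Prop :=
  ∃ e : V ≃ W, ∀ x y, G.Adj x y ↔ H.Adj (e x) (e y)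

/-- The connected component of `v`: all vertices that are joined to `v` by a finite path. -/
def component {V : Type*} (G : LoopyGraph V) (v : V) : Set V :=
  {w | Relation.ReflTransGen G.Adj v w}

/-- `C` is (the vertex set of) a connected component of `G`. -/
def IsComponent {V : Type*} (G : LoopyGraph V) (C : Set V) : Prop :=
  ∃ v, C = G.component v

end LoopyGraph

namespace ZFA

/-- The relation symbols of the language of set theory: one binary symbol. -/
inductive SetRel : ℕ → Type
  | mem : SetRel 2

/-- The language `{∈}` of set theory. -/
def setLang : FirstOrder.Language := ⟨fun _ => Empty, SetRel⟩

/-- `Mem x a` is `M ⊨ x ∈ a`. -/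
def Mem {M : Type*} [setLang.Structure M] (x a : M) : Prop :=
  FirstOrder.Language.Structure.RelMap (L := setLang) SetRel.mem ![x, a]

infix:50 " ∈ₘ " => Mem

/-- `M ⊨ c = {a, b}`. -/
def IsUPair {M : Type*} [setLang.Structure M] (c a b : M) : Prop :=
  ∀ z, z ∈ₘ c ↔ z = a ∨ z = b

/-- `M ⊨ p = (a, b)`, where `(a, b) = {{a}, {a, b}}` is the Kuratowski pair. -/
def IsOPair {M : Type*} [setLang.Structure M] (p a b : M) : Prop :=
  ∃ s t, IsUPair s a a ∧ IsUPair t a b ∧ IsUPair p s t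

/-- `M ⊨ (a, b) ∈ r`. -/
def Rel {M : Type*} [setLang.Structure M] (r a b : M) : Prop :=
  ∃ p, IsOPair p a b ∧ p ∈ₘ r

/-- `M ⊨ f is a function with domain X`. -/
def IsFunOn {M : Type*} [setLang.Structure M] (f X : M) : Prop :=
  (∀ p, p ∈ₘ f → ∃ x y, x ∈ₘ X ∧ IsOPair p x y) ∧ ∀ x, x ∈ₘ X → ∃! y, Rel f x y

/-- `M ⊨ S is a flat system of equations x = S_x (x ∈ X) with indeterminates X and set of
sets A`: the sets `X` and `A` are disjoint, `S` is a function on `X`, and each of its values is a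
subset of `X ∪ A`. -/
def IsFlatSystem {M : Type*} [setLang.Structure M] (X A S : M) : Prop :=
  (∀ z, ¬ (z ∈ₘ X ∧ z ∈ₘ A)) ∧ IsFunOn S X ∧
    ∀ x s, Rel S x s → ∀ z, z ∈ₘ s → z ∈ₘ X ∨ z ∈ₘ A

/-- `M ⊨ f is a solution of the flat system (X, A, S)`, that is, `f` is a function on `X` and
`f(x) = {f(y) : y ∈ S_x ∩ X} ∪ (S_x ∩ A)` for all `x ∈ X`. -/
def IsSolution {M : Type*} [setLang.Structure M] (X A S f : M) : Prop :=
  IsFunOn f X ∧ ∀ x s b, Rel S x s → Rel f x b →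
    ∀ z, z ∈ₘ b ↔ (∃ y, y ∈ₘ s ∧ y ∈ₘ X ∧ Rel f y z) ∨ (z ∈ₘ s ∧ z ∈ₘ A)

/-- `M ⊨ ZFA`: the axioms of ZFC other than Foundation, and the Anti-Foundation Axiom, are true
in `M`. In the two schemes `φ` runs over all first-order formulas of the language `{∈}`, and `p`
over all finite tuples of parameters. -/
structure IsModel (M : Type*) [setLang.Structure M] : Prop where
  extensionality : ∀ a b : M, (∀ z, z ∈ₘ a ↔ z ∈ₘ b) → a = b
  empty : ∃ a : M, ∀ z, ¬ z ∈ₘ a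
  pairing : ∀ a b : M, ∃ c, IsUPair c a b
  union : ∀ a : M, ∃ u, ∀ z, z ∈ₘ u ↔ ∃ y, y ∈ₘ a ∧ z ∈ₘ y
  powerset : ∀ a : M, ∃ q, ∀ y, y ∈ₘ q ↔ ∀ z, z ∈ₘ y → z ∈ₘ a
  infinity : ∃ w : M, (∃ e, e ∈ₘ w ∧ ∀ z, ¬ z ∈ₘ e) ∧
    ∀ x, x ∈ₘ w → ∃ s, s ∈ₘ w ∧ ∀ z, z ∈ₘ s ↔ z ∈ₘ x ∨ z = x
  separation : ∀ (n : ℕ) (φ : setLang.Formula (Fin n ⊕ Fin 1)) (p : Fin n → M) (a : M),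
    ∃ b, ∀ x, x ∈ₘ b ↔ x ∈ₘ a ∧ φ.Realize (Sum.elim p ![x])
  replacement : ∀ (n : ℕ) (φ : setLang.Formula (Fin n ⊕ Fin 2)) (p : Fin n → M) (a : M),
    (∀ x, x ∈ₘ a → ∃! y, φ.Realize (Sum.elim p ![x, y])) →
      ∃ b, ∀ y, y ∈ₘ b ↔ ∃ x, x ∈ₘ a ∧ φ.Realize (Sum.elim p ![x, y])
  choice : ∀ a : M, (∀ x, x ∈ₘ a → ∃ z, z ∈ₘ x) →
    (∀ x y, x ∈ₘ a → y ∈ₘ a → (∃ z, z ∈ₘ x ∧ z ∈ₘ y) → x = y) →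
      ∃ c, ∀ x, x ∈ₘ a → ∃! z, z ∈ₘ x ∧ z ∈ₘ c
  antiFoundation : ∀ X A S : M, IsFlatSystem X A S → ∃! f, IsSolution X A S f

/-- The D-graph (double-membership graph) `M₁` of `M`. -/
def dGraph (M : Type*) [setLang.Structure M] : LoopyGraph M where
  Adj x y := x ∈ₘ y ∧ y ∈ₘ x
  symm _ _ h := ⟨h.2, h.1⟩

/-- A graph in the sense of `M`: its domain is an `M`-set, and its edge relation is an `M`-set of
Kuratowski pairs of elements of the domain, and symmetric. -/
structure InternalGraph (M : Type*) [setLang.Structure M] where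
  dom : M
  edge : M
  edge_subset : ∀ p, p ∈ₘ edge → ∃ x y, x ∈ₘ dom ∧ y ∈ₘ dom ∧ IsOPair p x y
  symm : ∀ x y, Rel edge x y → Rel edge y x

/-- The actual graph given by a graph in the sense of `M`: its vertices are the elements `x` of
`M` with `M ⊨ x ∈ dom`. -/
def InternalGraph.toGraph {M : Type*} [setLang.Structure M] (G : InternalGraph M) :
    LoopyGraph {x : M // x ∈ₘ G.dom} where
  Adj x y := Rel G.edge x.1 y.1
  symm x y h := G.symm x.1 y.1 h

end ZFA

/-!
A component of the D-graph is contained in some transitive `T ∈ M`, and the restriction of double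
membership to `T` is a graph in the sense of `M`.

Conversely, the solution `F` of the flat system `x = {y : y ~ x} ∪ {{x, t}}`, where `x` and `y` run
over the vertices of a graph `G` in the sense of `M`, maps adjacent vertices to double members.
Let `B ∈ M` be a transitive superset of the vertex set, and choose `t ⊆ B` with `t ∉ B`. Then the
tags `{x, t}` are outside `B`, they make `F` injective, and `F x` is not an element of any tag, so
that `F` creates no further double memberships: it maps components of `G` isomorphically onto
components of the D-graph. All values of `F` are outside `B`, and `B` may be taken to contain any
given finite set, so infinitely many such copies arise.
-/

namespace LoopyGraph

variable {V W U : Type*} {G : LoopyGraph V} {H : LoopyGraph W} {K : LoopyGraph U}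

theorem IsIso.symm (h : G.IsIso H) : H.IsIso G := by
  obtain ⟨e, he⟩ := h
  exact ⟨e.symm, fun x y => by simp [he]⟩

theorem IsIso.trans (h : G.IsIso H) (h' : H.IsIso K) : G.IsIso K := by
  obtain ⟨e, he⟩ := h
  obtain ⟨e', he'⟩ := h'
  exact ⟨e.trans e', fun x y => by simp [he, he']⟩

theorem IsComponent.nonempty {C : Set V} (hC : G.IsComponent C) : C.Nonempty := by
  obtain ⟨v, rfl⟩ := hC
  exact ⟨v, .refl⟩

/-- `F` embeds `G` in `H` as a union of connected components: the neighbours of `F x` are exactly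
the images of the neighbours of `x`. -/
structure IsComponentEmbedding (G : LoopyGraph V) (H : LoopyGraph W) (F : V → W) : Prop where
  injective : Function.Injective F
  adj_iff : ∀ x w, H.Adj (F x) w ↔ ∃ y, G.Adj x y ∧ F y = w

namespace IsComponentEmbedding

variable {F : V → W}

theorem adj_map_iff (hF : G.IsComponentEmbedding H F) {x y : V} :
    H.Adj (F x) (F y) ↔ G.Adj x y := by
  simp only [hF.adj_iff, hF.injective.eq_iff, exists_eq_right]

theorem component_map (hF : G.IsComponentEmbedding H F) (v : V) :
    H.component (F v) = F '' G.component v := by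
  apply Set.Subset.antisymm
  · intro w hw
    induction hw with
    | refl => exact ⟨v, .refl, rfl⟩
    | tail _ hadj ih =>
      obtain ⟨x, hx, rfl⟩ := ih
      obtain ⟨y, hxy, rfl⟩ := (hF.adj_iff x _).1 hadj
      exact ⟨y, hx.tail hxy, rfl⟩
  · rintro _ ⟨x, hx, rfl⟩
    exact hx.lift F fun _ _ => hF.adj_map_iff.2

theorem induce_component_isIso (hF : G.IsComponentEmbedding H F) (v : V) :
    (H.induce (H.component (F v))).IsIso (G.induce (G.component v)) := by
  rw [hF.component_map]
  exact IsIso.symm ⟨Equiv.Set.image F _ hF.injective, fun _ _ => hF.adj_map_iff.symm⟩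

end IsComponentEmbedding

end LoopyGraph

namespace ZFA

open FirstOrder FirstOrder.Language

section Definability

variable {L : Language} {M : Type*} [L.Structure M] {α : Type}

variable (L) in
/-- The function `f` on tuples is first-order definable with parameters. As a class, it lets
instance resolution follow the way a formula is built up. -/
class DefinableFun (f : (α → M) → M) : Prop where
  definableFun : Set.univ.DefinableFun L f

variable (L) in
/-- The predicate `P` on tuples is first-order definable with parameters. As a class, it lets
instance resolution follow the way a formula is built up. -/
class DefinablePred (P : (α → M) → Prop) : Prop where
  definable : Set.univ.Definable L {v | P v}

variable (L) in
/-- The binary relation `R` is first-order definable with parameters. As a class, it lets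
instance resolution substitute definable functions into `R`. -/
class DefinableRel (R : M → M → Prop) : Prop where
  definablePred : DefinablePred L fun v : Fin 2 → M => R (v 0) (v 1)

instance DefinableFun.proj (i : α) : DefinableFun L fun v : α → M => v i :=
  ⟨.proj L⟩

instance DefinableFun.const (c : M) : DefinableFun L fun _ : α → M => c :=
  ⟨L.definableFun_const α (Set.mem_univ c)⟩

instance DefinableFun.reindex {β : Type} {f : (α → M) → M} [hf : DefinableFun L f] (g : α → β) :
    DefinableFun L fun w : β → M => f fun i => w (g i) :=
  ⟨hf.definableFun.preimage_comp (Option.map g)⟩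

instance DefinableRel.of_definablePred {R : M → M → Prop}
    [hR : DefinablePred L fun v : Fin 2 → M => R (v 0) (v 1)] : DefinableRel L R :=
  ⟨hR⟩

instance DefinableRel.eq : DefinableRel L (Eq : M → M → Prop) :=
  ⟨⟨Set.Definable.diagonal L _⟩⟩

namespace DefinablePred

variable {P Q : (α → M) → Prop}

instance comp_rel {R : M → M → Prop} [hR : DefinableRel L R] {s t : (α → M) → M}
    [hs : DefinableFun L s] [ht : DefinableFun L t] : DefinablePred L fun v => R (s v) (t v) := by
  have hst : Set.univ.DefinableMap L fun v => ![s v, t v] :=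
    Fin.forall_fin_two.2 ⟨hs.definableFun, ht.definableFun⟩
  exact ⟨hR.definablePred.definable.preimage_map hst⟩

theorem congr (hP : DefinablePred L P) (h : ∀ v, P v ↔ Q v) : DefinablePred L Q :=
  (funext fun v => propext (h v) : P = Q) ▸ hP

instance and [hP : DefinablePred L P] [hQ : DefinablePred L Q] :
    DefinablePred L fun v => P v ∧ Q v :=
  ⟨hP.definable.inter hQ.definable⟩

instance or [hP : DefinablePred L P] [hQ : DefinablePred L Q] :
    DefinablePred L fun v => P v ∨ Q v :=
  ⟨hP.definable.union hQ.definable⟩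

instance not [hP : DefinablePred L P] : DefinablePred L fun v => ¬ P v :=
  ⟨hP.definable.compl⟩

instance imp [DefinablePred L P] [DefinablePred L Q] : DefinablePred L fun v => P v → Q v :=
  congr (P := fun v => ¬ P v ∨ Q v) inferInstance fun _ => imp_iff_not_or.symm

instance iff [DefinablePred L P] [DefinablePred L Q] : DefinablePred L fun v => P v ↔ Q v :=
  congr (P := fun v => (P v → Q v) ∧ (Q v → P v)) inferInstance fun _ => iff_def.symm

section Quantifiers

variable {P : (α → M) → M → Prop}
  [hP : DefinablePred L fun w : Option α → M => P (fun i => w (some i)) (w none)]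
include hP

instance ex : DefinablePred L fun v => ∃ x, P v x :=
  congr (P := fun v => ∃ u : Unit → M, P v (u ()))
    ⟨(hP.definable.preimage_comp (Equiv.optionEquivSumPUnit α)).exists_of_finite⟩
    fun _ => ⟨fun ⟨u, hu⟩ => ⟨u (), hu⟩, fun ⟨x, hx⟩ => ⟨fun _ => x, hx⟩⟩

instance all : DefinablePred L fun v => ∀ x, P v x :=
  congr (P := fun v => ¬ ∃ x, ¬ P v x) inferInstance fun _ => not_exists_not

end Quantifiers

theorem exists_formula (hP : DefinablePred L P) :
    ∃ (n : ℕ) (φ : L.Formula (Fin n ⊕ α)) (p : Fin n → M),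
      ∀ v, φ.Realize (Sum.elim p v) ↔ P v := by
  obtain ⟨A, -, hA⟩ := Set.definable_iff_finitely_definable.1 hP.definable
  obtain ⟨φ, hφ⟩ := Set.definable_iff_exists_formula_sum.1 hA
  refine ⟨A.card, φ.relabel (Sum.map A.equivFin id), Subtype.val ∘ A.equivFin.symm, fun v => ?_⟩
  rw [Formula.realize_relabel, Sum.elim_comp_map, Function.comp_assoc, Equiv.symm_comp_self]
  exact (Set.ext_iff.1 hφ v).symm

end DefinablePred

end Definability

variable {M : Type*} [setLang.Structure M]

/-- `M ⊨ e = ∅`. -/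
def IsEmptySet (e : M) : Prop := ∀ z, ¬ z ∈ₘ e

/-- `M ⊨ s = x ∪ {x}`. -/
def IsSucc (s x : M) : Prop := ∀ z, z ∈ₘ s ↔ z ∈ₘ x ∨ z = x

/-- `M ⊨ u = ⋃ a`. -/
def IsUnion (u a : M) : Prop := ∀ z, z ∈ₘ u ↔ ∃ y, y ∈ₘ a ∧ z ∈ₘ y

/-- `M ⊨ t is a transitive set`. -/
def IsTransitive (t : M) : Prop := ∀ x, x ∈ₘ t → ∀ z, z ∈ₘ x → z ∈ₘ t

/-- `M ⊨ t ⊆ b and t ∉ b`. The set `t` serves to mark the elements `x` of a transitive set `b` by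
tags `{x, t}` outside `b`. -/
structure IsFresh (t b : M) : Prop where
  subset : ∀ z, z ∈ₘ t → z ∈ₘ b
  not_mem : ¬ t ∈ₘ b

/-- `M ⊨ w is an inductive set`: `w` contains `∅` and is closed under `x ↦ x ∪ {x}`. -/
def IsInductive (w : M) : Prop :=
  (∃ e, e ∈ₘ w ∧ IsEmptySet e) ∧ ∀ x, x ∈ₘ w → ∃ s, s ∈ₘ w ∧ IsSucc s x

/-- `M ⊨ w = ω`, with `ω` taken as the least inductive set. -/
def IsOmega (w : M) : Prop :=
  IsInductive w ∧ ∀ y, IsInductive y → ∀ x, x ∈ₘ w → x ∈ₘ y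

/-- The relation coded by `f` in `M` justifies each of its pairs `(k, s)` by a clause of the
recursion on `w` whose initial value is `a` and whose step is `R`. -/
def IsAttempt (R : M → M → Prop) (w a f : M) : Prop :=
  ∀ k s, Rel f k s → (IsEmptySet k ∧ s = a) ∨ ∃ l t, l ∈ₘ w ∧ IsSucc k l ∧ Rel f l t ∧ R t s

/-- In `M`, the `k`-th iterate of `R` from `a` is `s`, where `k` is in `w = ω`. -/
def IsIterate (R : M → M → Prop) (w a k s : M) : Prop :=
  ∃ f, IsAttempt R w a f ∧ Rel f k s

section DefinableNotions

variable {α : Type} {a b c d : (α → M) → M} [DefinableFun setLang a] [DefinableFun setLang b]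
  [DefinableFun setLang c] [DefinableFun setLang d]

instance DefinableRel.mem : DefinableRel setLang (Mem : M → M → Prop) := by
  let memSymbol : setLang.Relations 2 := SetRel.mem
  let φ : setLang.Formula (Fin 2) := memSymbol.formula₂ (.var 0) (.var 1)
  have hφ : ∀ v : Fin 2 → M, φ.Realize v ↔ v 0 ∈ₘ v 1 := fun _ => Formula.realize_rel₂
  exact ⟨⟨.mono (Set.empty_definable_iff.2 ⟨φ, Set.ext fun v => (hφ v).symm⟩)
    (Set.empty_subset _)⟩⟩

instance DefinablePred.isUPair : DefinablePred setLang fun v => IsUPair (a v) (b v) (c v) := by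
  unfold IsUPair; infer_instance

instance DefinablePred.isOPair : DefinablePred setLang fun v => IsOPair (a v) (b v) (c v) := by
  unfold IsOPair; infer_instance

instance DefinablePred.rel : DefinablePred setLang fun v => Rel (a v) (b v) (c v) := by
  unfold Rel; infer_instance

instance DefinablePred.isEmptySet : DefinablePred setLang fun v => IsEmptySet (a v) := by
  unfold IsEmptySet; infer_instance

instance DefinableRel.isSucc : DefinableRel setLang (IsSucc : M → M → Prop) := by
  unfold IsSucc; infer_instance

instance DefinableRel.isUnion : DefinableRel setLang (IsUnion : M → M → Prop) := by
  unfold IsUnion; infer_instance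

instance DefinablePred.isTransitive : DefinablePred setLang fun v => IsTransitive (a v) := by
  unfold IsTransitive; infer_instance

instance DefinablePred.isInductive : DefinablePred setLang fun v => IsInductive (a v) := by
  unfold IsInductive; infer_instance

instance DefinableRel.adj_dGraph : DefinableRel setLang (dGraph M).Adj := by
  unfold dGraph; infer_instance

instance DefinablePred.isIterate {R : M → M → Prop} [DefinableRel setLang R] :
    DefinablePred setLang fun v => IsIterate R (a v) (b v) (c v) (d v) := by
  unfold IsIterate IsAttempt; infer_instance

end DefinableNotions

namespace IsUPair

variable {p a b c : M}

theorem left_mem (h : IsUPair p a b) : a ∈ₘ p := (h a).2 (.inl rfl)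

theorem right_mem (h : IsUPair p a b) : b ∈ₘ p := (h b).2 (.inr rfl)

theorem swap (h : IsUPair p a b) : IsUPair p b a := fun z => (h z).trans or_comm

theorem mem_iff_eq (h : IsUPair p a a) (z : M) : z ∈ₘ p ↔ z = a := (h z).trans or_self_iff

theorem right_inj (h : IsUPair p a b) (h' : IsUPair p a c) : b = c := by
  have hb := (h' b).1 h.right_mem
  have hc := (h c).1 h'.right_mem
  grind

end IsUPair

/-- `M ⊨ ZF⁻`, that is, the axioms of ZF other than Foundation are true in `M`. -/
structure IsZFMinusModel (M : Type*) [setLang.Structure M] : Prop where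
  extensionality : ∀ a b : M, (∀ z, z ∈ₘ a ↔ z ∈ₘ b) → a = b
  pairing : ∀ a b : M, ∃ c, IsUPair c a b
  union : ∀ a : M, ∃ u, IsUnion u a
  powerset : ∀ a : M, ∃ q, ∀ y, y ∈ₘ q ↔ ∀ z, z ∈ₘ y → z ∈ₘ a
  infinity : ∃ w : M, IsInductive w
  separation : ∀ (n : ℕ) (φ : setLang.Formula (Fin n ⊕ Fin 1)) (p : Fin n → M) (a : M),
    ∃ b, ∀ x, x ∈ₘ b ↔ x ∈ₘ a ∧ φ.Realize (Sum.elim p ![x])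
  replacement : ∀ (n : ℕ) (φ : setLang.Formula (Fin n ⊕ Fin 2)) (p : Fin n → M) (a : M),
    (∀ x, x ∈ₘ a → ∃! y, φ.Realize (Sum.elim p ![x, y])) →
      ∃ b, ∀ y, y ∈ₘ b ↔ ∃ x, x ∈ₘ a ∧ φ.Realize (Sum.elim p ![x, y])

/-- `M ⊨ AFA₁`, the existence half of the Anti-Foundation Axiom: every flat system of equations
has a solution. -/
def SatisfiesAFA₁ (M : Type*) [setLang.Structure M] : Prop :=
  ∀ X A S : M, IsFlatSystem X A S → ∃ f, IsSolution X A S f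

theorem IsModel.isZFMinusModel (hM : IsModel M) : IsZFMinusModel M :=
  { hM with }

theorem IsModel.satisfiesAFA₁ (hM : IsModel M) : SatisfiesAFA₁ M :=
  fun X A S h => (hM.antiFoundation X A S h).exists

namespace IsZFMinusModel

variable (hM : IsZFMinusModel M)
include hM

section SetExistence

theorem ext {a b : M} (h : ∀ z, z ∈ₘ a ↔ z ∈ₘ b) : a = b := hM.extensionality a b h

theorem exists_sep (P : M → Prop) [hP : DefinablePred setLang fun v : Fin 1 → M => P (v 0)]
    (a : M) : ∃ b, ∀ x, x ∈ₘ b ↔ x ∈ₘ a ∧ P x := by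
  obtain ⟨n, φ, p, hφ⟩ := hP.exists_formula
  simpa [hφ] using hM.separation n φ p a

theorem exists_image (R : M → M → Prop) [hR : DefinableRel setLang R] (a : M)
    (h : ∀ x, x ∈ₘ a → ∃! y, R x y) : ∃ b, ∀ y, y ∈ₘ b ↔ ∃ x, x ∈ₘ a ∧ R x y := by
  obtain ⟨n, φ, p, hφ⟩ := hR.definablePred.exists_formula
  have hrep := hM.replacement n φ p a
  simp only [hφ, Matrix.cons_val_zero, Matrix.cons_val_one] at hrep
  exact hrep h

theorem exists_union₂ (a b : M) : ∃ c, ∀ z, z ∈ₘ c ↔ z ∈ₘ a ∨ z ∈ₘ b := by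
  obtain ⟨p, hp⟩ := hM.pairing a b
  obtain ⟨u, hu⟩ := hM.union p
  exact ⟨u, fun z => by simp [hu z, hp _]⟩

theorem exists_insert (a b : M) : ∃ c, ∀ z, z ∈ₘ c ↔ z ∈ₘ a ∨ z = b := by
  obtain ⟨s, hs⟩ := hM.pairing b b
  obtain ⟨c, hc⟩ := hM.exists_union₂ a s
  exact ⟨c, fun z => by rw [hc, hs.mem_iff_eq]⟩

theorem exists_isFresh (b : M) : ∃ t, IsFresh t b := by
  -- The Russell subset of `b`.
  obtain ⟨t, ht⟩ := hM.exists_sep (fun z => ¬ z ∈ₘ z) b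
  have htt : ¬ t ∈ₘ t := fun h => ((ht t).1 h).2 h
  exact ⟨t, fun z hz => ((ht z).1 hz).1, fun htb => htt ((ht t).2 ⟨htb, htt⟩)⟩

theorem exists_mem_of_finite {s : Set M} (hs : s.Finite) : ∃ b : M, ∀ x ∈ s, x ∈ₘ b := by
  induction s, hs using Set.Finite.induction_on with
  | empty => exact hM.infinity.imp fun _ _ _ hx => hx.elim
  | @insert a s _ _ ih =>
    obtain ⟨b, hb⟩ := ih
    obtain ⟨c, hc⟩ := hM.exists_insert b a
    exact ⟨c, fun x hx => (hc x).2 (hx.symm.imp_left (hb x))⟩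

theorem upair_unique {p q a b : M} (h : IsUPair p a b) (h' : IsUPair q a b) : p = q :=
  hM.ext fun z => (h z).trans (h' z).symm

theorem exists_opair (a b : M) : ∃ p, IsOPair p a b := by
  obtain ⟨s, hs⟩ := hM.pairing a a
  obtain ⟨t, ht⟩ := hM.pairing a b
  obtain ⟨p, hp⟩ := hM.pairing s t
  exact ⟨p, s, t, hs, ht, hp⟩

theorem opair_unique {p q a b : M} (h : IsOPair p a b) (h' : IsOPair q a b) : p = q := by
  obtain ⟨s, t, hs, ht, hp⟩ := h
  obtain ⟨s', t', hs', ht', hq⟩ := h'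
  obtain rfl := hM.upair_unique hs hs'
  obtain rfl := hM.upair_unique ht ht'
  exact hM.upair_unique hp hq

theorem opair_inj {p a b c d : M} (h : IsOPair p a b) (h' : IsOPair p c d) : a = c ∧ b = d := by
  obtain ⟨s, t, hs, ht, hp⟩ := h
  obtain ⟨s', t', hs', ht', hp'⟩ := h'
  have hac : a = c := by
    rcases (hp s').1 hp'.left_mem with rfl | rfl
    · exact (hs'.mem_iff_eq a).1 hs.left_mem
    · exact (hs'.mem_iff_eq a).1 ht.left_mem
  subst hac
  obtain rfl := hM.upair_unique hs hs'
  obtain rfl := hp.right_inj hp'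
  exact ⟨rfl, ht.right_inj ht'⟩

theorem exists_insert_rel (f k s : M) :
    ∃ g, ∀ x y, Rel g x y ↔ Rel f x y ∨ (x = k ∧ y = s) := by
  obtain ⟨p, hp⟩ := hM.exists_opair k s
  obtain ⟨g, hg⟩ := hM.exists_insert f p
  refine ⟨g, fun x y => ⟨?_, ?_⟩⟩
  · rintro ⟨q, hq, hqg⟩
    rcases (hg q).1 hqg with hqf | rfl
    · exact .inl ⟨q, hq, hqf⟩
    · exact .inr (hM.opair_inj hq hp)
  · rintro (⟨q, hq, hqf⟩ | ⟨rfl, rfl⟩)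
    · exact ⟨q, hq, (hg q).2 (.inl hqf)⟩
    · exact ⟨p, hp, (hg p).2 (.inr rfl)⟩

theorem exists_function (R : M → M → Prop) [DefinableRel setLang R] (X : M)
    (hR : ∀ x, x ∈ₘ X → ∃! y, R x y) :
    ∃ f, IsFunOn f X ∧ ∀ x y, Rel f x y ↔ x ∈ₘ X ∧ R x y := by
  obtain ⟨f, hf⟩ := hM.exists_image (fun x p => ∃ y, IsOPair p x y ∧ R x y) X fun x hx => by
    obtain ⟨y, hxy, hy⟩ := hR x hx
    obtain ⟨p, hp⟩ := hM.exists_opair x y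
    refine ⟨p, ⟨y, hp, hxy⟩, ?_⟩
    rintro q ⟨y', hq, hxy'⟩
    obtain rfl := hy y' hxy'
    exact hM.opair_unique hq hp
  have hrel : ∀ x y, Rel f x y ↔ x ∈ₘ X ∧ R x y := by
    refine fun x y => ⟨?_, fun ⟨hx, hxy⟩ => ?_⟩
    · rintro ⟨p, hp, hpf⟩
      obtain ⟨x', hx', y', hp', hxy'⟩ := (hf p).1 hpf
      obtain ⟨rfl, rfl⟩ := hM.opair_inj hp hp'
      exact ⟨hx', hxy'⟩
    · obtain ⟨p, hp⟩ := hM.exists_opair x y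
      exact ⟨p, hp, (hf p).2 ⟨x, hx, y, hp, hxy⟩⟩
  refine ⟨f, ⟨fun p hp => ?_, fun x hx => ?_⟩, hrel⟩
  · obtain ⟨x, hx, y, hpxy, -⟩ := (hf p).1 hp
    exact ⟨x, y, hx, hpxy⟩
  · simpa only [hrel, hx, true_and] using hR x hx

theorem exists_forall_opair_mem (T : M) :
    ∃ B, ∀ p x y, x ∈ₘ T → y ∈ₘ T → IsOPair p x y → p ∈ₘ B := by
  obtain ⟨Q, hQ⟩ := hM.powerset T
  obtain ⟨B, hB⟩ := hM.powerset Q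
  have mem_Q : ∀ s x y, x ∈ₘ T → y ∈ₘ T → IsUPair s x y → s ∈ₘ Q := fun s x y hx hy hs =>
    (hQ s).2 fun z hz => by rcases (hs z).1 hz with rfl | rfl <;> assumption
  refine ⟨B, fun p x y hx hy ⟨s, t, hs, ht, hp⟩ => (hB p).2 fun z hz => ?_⟩
  rcases (hp z).1 hz with rfl | rfl
  exacts [mem_Q _ x x hx hx hs, mem_Q _ x y hx hy ht]

theorem exists_internalGraph (R : M → M → Prop) [DefinableRel setLang R]
    (hR : ∀ x y, R x y → R y x) (T : M) :
    ∃ G : InternalGraph M, G.dom = T ∧ ∀ x y, Rel G.edge x y ↔ x ∈ₘ T ∧ y ∈ₘ T ∧ R x y := by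
  obtain ⟨B, hB⟩ := hM.exists_forall_opair_mem T
  obtain ⟨r, hr⟩ := hM.exists_sep
    (fun p => ∃ x y, IsOPair p x y ∧ x ∈ₘ T ∧ y ∈ₘ T ∧ R x y) B
  have hrel : ∀ x y, Rel r x y ↔ x ∈ₘ T ∧ y ∈ₘ T ∧ R x y := by
    refine fun x y => ⟨?_, fun h => ?_⟩
    · rintro ⟨p, hp, hpr⟩
      obtain ⟨-, x', y', hp', h⟩ := (hr p).1 hpr
      obtain ⟨rfl, rfl⟩ := hM.opair_inj hp hp'
      exact h
    · obtain ⟨p, hp⟩ := hM.exists_opair x y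
      exact ⟨p, hp, (hr p).2 ⟨hB p x y h.1 h.2.1 hp, x, y, hp, h⟩⟩
  refine ⟨⟨T, r, fun p hp => ?_, fun x y h => ?_⟩, rfl, hrel⟩
  · obtain ⟨-, x, y, hpxy, hx, hy, -⟩ := (hr p).1 hp
    exact ⟨x, y, hx, hy, hpxy⟩
  · obtain ⟨hx, hy, hxy⟩ := (hrel x y).1 h
    exact (hrel y x).2 ⟨hy, hx, hR x y hxy⟩

end SetExistence

section Recursion

theorem exists_isOmega : ∃ w : M, IsOmega w := by
  obtain ⟨w₀, ⟨e, he, he_empty⟩, hsucc⟩ := hM.infinity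
  obtain ⟨w, hw⟩ := hM.exists_sep (fun x => ∀ y, IsInductive y → x ∈ₘ y) w₀
  refine ⟨w, ⟨⟨e, (hw e).2 ⟨he, fun y hy => ?_⟩, he_empty⟩, fun x hx => ?_⟩,
    fun y hy x hx => ((hw x).1 hx).2 y hy⟩
  · obtain ⟨e', he', he'_empty⟩ := hy.1
    rwa [hM.ext (a := e) (b := e') fun z => iff_of_false (he_empty z) (he'_empty z)]
  · obtain ⟨hx₀, hx_mem⟩ := (hw x).1 hx
    obtain ⟨s, hs, hsx⟩ := hsucc x hx₀
    refine ⟨s, (hw s).2 ⟨hs, fun y hy => ?_⟩, hsx⟩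
    obtain ⟨s', hs', hsx'⟩ := hy.2 x (hx_mem y hy)
    rwa [hM.ext (a := s) (b := s') fun z => (hsx z).trans (hsx' z).symm]

theorem omega_induction {w : M} (hw : IsOmega w) (P : M → Prop)
    [DefinablePred setLang fun v : Fin 1 → M => P (v 0)] (zero : ∀ e, IsEmptySet e → P e)
    (succ : ∀ x s, x ∈ₘ w → IsSucc s x → P x → P s) : ∀ x, x ∈ₘ w → P x := by
  obtain ⟨u, hu⟩ := hM.exists_sep P w
  have hu_inductive : IsInductive u := by
    obtain ⟨⟨e, he, he_empty⟩, hsucc⟩ := hw.1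
    refine ⟨⟨e, (hu e).2 ⟨he, zero e he_empty⟩, he_empty⟩, fun x hx => ?_⟩
    obtain ⟨hxw, hPx⟩ := (hu x).1 hx
    obtain ⟨s, hs, hsx⟩ := hsucc x hxw
    exact ⟨s, (hu s).2 ⟨hs, succ x s hxw hsx hPx⟩, hsx⟩
  exact fun x hx => ((hu x).1 (hw.2 u hu_inductive x hx)).2

theorem isTransitive_of_mem_omega {w : M} (hw : IsOmega w) : ∀ x, x ∈ₘ w → IsTransitive x := by
  refine hM.omega_induction hw _ (fun e he x hx => (he x hx).elim) fun x s _ hs hx y hy z hz => ?_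
  rcases (hs y).1 hy with hyx | rfl
  exacts [(hs z).2 (.inl (hx y hyx z hz)), (hs z).2 (.inl hz)]

theorem not_mem_self_of_mem_omega {w : M} (hw : IsOmega w) : ∀ x, x ∈ₘ w → ¬ x ∈ₘ x := by
  refine hM.omega_induction hw _ (fun e he => he e) fun x s hx hs hxx hss => ?_
  have hxs : x ∈ₘ s := (hs x).2 (.inr rfl)
  rcases (hs s).1 hss with hsx | rfl
  exacts [hxx (hM.isTransitive_of_mem_omega hw x hx s hsx x hxs), hxx hxs]

theorem succ_inj_of_mem_omega {w : M} (hw : IsOmega w) {k l l' : M} (hl : l ∈ₘ w)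
    (hkl : IsSucc k l) (hkl' : IsSucc k l') : l = l' := by
  by_contra hne
  have hll' : l ∈ₘ l' := ((hkl' l).1 ((hkl l).2 (.inr rfl))).resolve_right hne
  have hl'l : l' ∈ₘ l := ((hkl l').1 ((hkl' l').2 (.inr rfl))).resolve_right (Ne.symm hne)
  exact hM.not_mem_self_of_mem_omega hw l hl (hM.isTransitive_of_mem_omega hw l hl l' hl'l l hll')

variable {R : M → M → Prop} {w a : M}

theorem isIterate_zero_iff {e s : M} (he : IsEmptySet e) : IsIterate R w a e s ↔ s = a := by
  constructor
  · rintro ⟨f, hf, hes⟩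
    rcases hf e s hes with ⟨-, hs⟩ | ⟨l, -, -, hel, -⟩
    · exact hs
    · exact (he l ((hel l).2 (.inr rfl))).elim
  · rintro rfl
    obtain ⟨g, hg⟩ := hM.exists_insert_rel e e s
    refine ⟨g, fun k t hkt => .inl ?_, (hg e s).2 (.inr ⟨rfl, rfl⟩)⟩
    rcases (hg k t).1 hkt with ⟨p, -, hp⟩ | ⟨rfl, rfl⟩
    exacts [(he p hp).elim, ⟨he, rfl⟩]

theorem isIterate_succ_iff (hw : IsOmega w) {k l s : M} (hl : l ∈ₘ w) (hk : IsSucc k l) :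
    IsIterate R w a k s ↔ ∃ t, IsIterate R w a l t ∧ R t s := by
  constructor
  · rintro ⟨f, hf, hks⟩
    rcases hf k s hks with ⟨hk_empty, -⟩ | ⟨l', t, -, hkl', hlt, hts⟩
    · exact (hk_empty l ((hk l).2 (.inr rfl))).elim
    · obtain rfl := hM.succ_inj_of_mem_omega hw hl hk hkl'
      exact ⟨t, ⟨f, hf, hlt⟩, hts⟩
  · rintro ⟨t, ⟨f, hf, hlt⟩, hts⟩
    obtain ⟨g, hg⟩ := hM.exists_insert_rel f k s
    have hfg : ∀ x y, Rel f x y → Rel g x y := fun x y h => (hg x y).2 (.inl h)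
    refine ⟨g, fun i u hiu => ?_, (hg k s).2 (.inr ⟨rfl, rfl⟩)⟩
    rcases (hg i u).1 hiu with hiu | ⟨rfl, rfl⟩
    · refine (hf i u hiu).imp_right ?_
      rintro ⟨j, v, hj, hij, hjv, hvu⟩
      exact ⟨j, v, hj, hij, hfg j v hjv, hvu⟩
    · exact .inr ⟨l, t, hl, hk, hfg l t hlt, hts⟩

variable [DefinableRel setLang R]

theorem existsUnique_isIterate (hw : IsOmega w) (hR : ∀ x, ∃! y, R x y) :
    ∀ k, k ∈ₘ w → ∃! s, IsIterate R w a k s := by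
  unfold ExistsUnique
  refine hM.omega_induction hw _ (fun e he => ?_) fun l k hl hk ⟨t, hlt, ht⟩ => ?_
  · simp only [hM.isIterate_zero_iff he]
    exact ⟨a, rfl, fun _ => id⟩
  · obtain ⟨s, hts, hs⟩ := hR t
    simp only [hM.isIterate_succ_iff hw hl hk]
    refine ⟨s, ⟨t, hlt, hts⟩, ?_⟩
    rintro s' ⟨t', hlt', hts'⟩
    obtain rfl := ht t' hlt'
    exact hs s' hts'

theorem exists_mem_closed_under (hR : ∀ x, ∃! y, R x y) (a : M) :
    ∃ b, a ∈ₘ b ∧ ∀ x y, x ∈ₘ b → R x y → y ∈ₘ b := by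
  obtain ⟨w, hw⟩ := hM.exists_isOmega
  obtain ⟨b, hb⟩ := hM.exists_image (IsIterate R w a) w (hM.existsUnique_isIterate hw hR)
  refine ⟨b, ?_, fun x y hx hxy => ?_⟩
  · obtain ⟨e, he, he_empty⟩ := hw.1.1
    exact (hb a).2 ⟨e, he, (hM.isIterate_zero_iff he_empty).2 rfl⟩
  · obtain ⟨l, hl, hlx⟩ := (hb x).1 hx
    obtain ⟨k, hk, hkl⟩ := hw.1.2 l hl
    exact (hb y).2 ⟨k, hk, (hM.isIterate_succ_iff hw hl hkl).2 ⟨x, hlx, hxy⟩⟩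

end Recursion

theorem exists_isTransitive_mem (a : M) : ∃ T : M, a ∈ₘ T ∧ IsTransitive T := by
  obtain ⟨s, hs⟩ := hM.pairing a a
  obtain ⟨b, hsb, hb⟩ := hM.exists_mem_closed_under (R := fun x u => IsUnion u x)
    (fun x => by
      obtain ⟨u, hu⟩ := hM.union x
      exact ⟨u, hu, fun u' hu' => hM.ext fun z => (hu' z).trans (hu z).symm⟩) s
  obtain ⟨T, hT⟩ := hM.union b
  refine ⟨T, (hT a).2 ⟨s, hsb, hs.left_mem⟩, fun x hx z hz => ?_⟩
  obtain ⟨y, hyb, hxy⟩ := (hT x).1 hx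
  obtain ⟨u, hu⟩ := hM.union y
  exact (hT z).2 ⟨u, hb y u hyb hu, (hu z).2 ⟨x, hxy, hz⟩⟩

theorem exists_internalGraph_component_isIso {C : Set M} (hC : (dGraph M).IsComponent C) :
    ∃ (G : InternalGraph M) (C' : Set {x : M // x ∈ₘ G.dom}), G.toGraph.IsComponent C' ∧
      ((dGraph M).induce C).IsIso (G.toGraph.induce C') := by
  obtain ⟨v, rfl⟩ := hC
  obtain ⟨T, hvT, hT⟩ := hM.exists_isTransitive_mem v
  obtain ⟨G, rfl, hG⟩ := hM.exists_internalGraph (dGraph M).Adj (dGraph M).symm T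
  have hval : G.toGraph.IsComponentEmbedding (dGraph M) Subtype.val := by
    refine ⟨Subtype.val_injective, fun x w => ⟨fun hxw => ?_, ?_⟩⟩
    · have hw : w ∈ₘ G.dom := hT x.1 x.2 w hxw.2
      exact ⟨⟨w, hw⟩, (hG x.1 w).2 ⟨x.2, hw, hxw⟩, rfl⟩
    · rintro ⟨y, hxy, rfl⟩
      exact ((hG x.1 y.1).1 hxy).2.2
  exact ⟨G, _, ⟨⟨v, hvT⟩, rfl⟩, hval.induce_component_isIso ⟨v, hvT⟩⟩

theorem exists_flatSolution (hAFA : SatisfiesAFA₁ M) (R : M → M → Prop) [DefinableRel setLang R]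
    {X A : M} (hXA : ∀ z, z ∈ₘ X → ¬ z ∈ₘ A) :
    ∃ F : {x : M // x ∈ₘ X} → M, ∀ x z, z ∈ₘ F x ↔
      (∃ y : {x : M // x ∈ₘ X}, R x.1 y.1 ∧ F y = z) ∨ (R x.1 z ∧ z ∈ₘ A) := by
  obtain ⟨D, hD⟩ := hM.exists_union₂ X A
  have hrhs : ∀ x, ∃! s, ∀ z, z ∈ₘ s ↔ z ∈ₘ D ∧ R x z := fun x => by
    obtain ⟨s, hs⟩ := hM.exists_sep (R x) D
    exact ⟨s, hs, fun s' hs' => hM.ext fun z => (hs' z).trans (hs z).symm⟩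
  obtain ⟨S, hSX, hS⟩ := hM.exists_function (fun x s => ∀ z, z ∈ₘ s ↔ z ∈ₘ D ∧ R x z) X
    fun x _ => hrhs x
  have hflat : IsFlatSystem X A S :=
    ⟨fun z hz => hXA z hz.1 hz.2, hSX, fun x s hxs z hz =>
      (hD z).1 ((((hS x s).1 hxs).2 z).1 hz).1⟩
  obtain ⟨f, hf, hsol⟩ := hAFA X A S hflat
  choose F hF hF_unique using fun x : {x : M // x ∈ₘ X} => hf.2 x.1 x.2
  refine ⟨F, fun x z => ?_⟩
  obtain ⟨s, hs, -⟩ := hrhs x.1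
  rw [hsol x.1 s (F x) ((hS x.1 s).2 ⟨x.2, hs⟩) (hF x) z]
  refine or_congr ⟨?_, ?_⟩ ⟨fun ⟨hzs, hzA⟩ => ⟨((hs z).1 hzs).2, hzA⟩,
    fun ⟨hxz, hzA⟩ => ⟨(hs z).2 ⟨(hD z).2 (.inr hzA), hxz⟩, hzA⟩⟩
  · rintro ⟨y, hys, hyX, hyz⟩
    exact ⟨⟨y, hyX⟩, ((hs y).1 hys).2, (hF_unique ⟨y, hyX⟩ z hyz).symm⟩
  · rintro ⟨y, hxy, rfl⟩
    exact ⟨y.1, (hs y.1).2 ⟨(hD y.1).2 (.inl y.2), hxy⟩, y.2, hF y⟩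

end IsZFMinusModel

/-- `F` solves the equations `x = {y : y ~ x} ∪ {{x, t}}` attached to the vertices of `G`. The tag
`{x, t}` makes the solutions for different vertices distinct. -/
def IsTaggedSolution (G : InternalGraph M) (t : M) (F : {x : M // x ∈ₘ G.dom} → M) : Prop :=
  ∀ x z, z ∈ₘ F x ↔ (∃ y, G.toGraph.Adj x y ∧ F y = z) ∨ IsUPair z x.1 t

theorem IsZFMinusModel.exists_isTaggedSolution (hM : IsZFMinusModel M) (hAFA : SatisfiesAFA₁ M)
    (G : InternalGraph M) {t : M} (ht : ∀ x z, x ∈ₘ G.dom → IsUPair z x t → ¬ z ∈ₘ G.dom) :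
    ∃ F, IsTaggedSolution G t F := by
  obtain ⟨A, hA⟩ := hM.exists_image (fun x z => IsUPair z x t) G.dom fun x _ => by
    obtain ⟨z, hz⟩ := hM.pairing x t
    exact ⟨z, hz, fun z' hz' => hM.upair_unique hz' hz⟩
  have hdisj : ∀ z, z ∈ₘ G.dom → ¬ z ∈ₘ A := fun z hz hzA => by
    obtain ⟨x, hx, hzx⟩ := (hA z).1 hzA
    exact ht x z hx hzx hz
  obtain ⟨F, hF⟩ := hM.exists_flatSolution hAFA
    (fun x z => (z ∈ₘ G.dom ∧ Rel G.edge x z) ∨ IsUPair z x t) hdisj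
  refine ⟨F, fun x z => (hF x z).trans (or_congr ?_ ?_)⟩
  · refine exists_congr fun y => and_congr_left fun _ => ⟨fun h => ?_, fun h => .inl ⟨y.2, h⟩⟩
    exact (h.resolve_right fun hyx => ht x.1 y.1 x.2 hyx y.2).2
  · refine ⟨fun ⟨h, hzA⟩ => h.resolve_left fun hz => hdisj z hz.1 hzA, fun h => ?_⟩
    exact ⟨.inr h, (hA z).2 ⟨x.1, x.2, h⟩⟩

namespace IsFresh

variable {B t x z u : M} (ht : IsFresh t B)
include ht

theorem tag_not_mem (hB : IsTransitive B) (hz : IsUPair z x t) : ¬ z ∈ₘ B :=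
  fun hzB => ht.not_mem (hB z hzB t hz.right_mem)

theorem not_mem_tag (hx : x ∈ₘ B) (hz : IsUPair z x t) (huB : ¬ u ∈ₘ B)
    (hu : ∃ y, y ∈ₘ u ∧ ¬ y ∈ₘ B) : ¬ u ∈ₘ z := by
  intro huz
  rcases (hz u).1 huz with rfl | rfl
  · exact huB hx
  · obtain ⟨y, hyu, hyB⟩ := hu
    exact hyB (ht.subset y hyu)

end IsFresh

namespace IsTaggedSolution

variable {G : InternalGraph M} {t : M} {F : {x : M // x ∈ₘ G.dom} → M} {B : M}
  (hF : IsTaggedSolution G t F) (hM : IsZFMinusModel M) (ht : IsFresh t B) (hB : IsTransitive B)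
include hF hM ht hB

theorem exists_mem_not_mem (x : {x : M // x ∈ₘ G.dom}) : ∃ z, z ∈ₘ F x ∧ ¬ z ∈ₘ B := by
  obtain ⟨z, hz⟩ := hM.pairing x.1 t
  exact ⟨z, (hF x z).2 (.inr hz), ht.tag_not_mem hB hz⟩

theorem not_mem (x : {x : M // x ∈ₘ G.dom}) : ¬ F x ∈ₘ B := fun hx => by
  obtain ⟨z, hz, hzB⟩ := hF.exists_mem_not_mem hM ht hB x
  exact hzB (hB _ hx z hz)

variable (hGB : ∀ x, x ∈ₘ G.dom → x ∈ₘ B)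
include hGB

theorem not_mem_tag {x z : M} (hx : x ∈ₘ G.dom) (hz : IsUPair z x t)
    (y : {x : M // x ∈ₘ G.dom}) : ¬ F y ∈ₘ z :=
  ht.not_mem_tag (hGB x hx) hz (hF.not_mem hM ht hB y) (hF.exists_mem_not_mem hM ht hB y)

theorem ne_tag {x z : M} (hx : x ∈ₘ G.dom) (hz : IsUPair z x t)
    (y : {x : M // x ∈ₘ G.dom}) : F y ≠ z := by
  rintro rfl
  obtain ⟨a, ha⟩ := hM.pairing y.1 t
  have ha_not_mem : ¬ a ∈ₘ F y := ht.not_mem_tag (hGB x hx) hz (ht.tag_not_mem hB ha)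
    ⟨t, ha.right_mem, ht.not_mem⟩
  exact ha_not_mem ((hF y a).2 (.inr ha))

theorem injective : Function.Injective F := by
  intro x y hxy
  obtain ⟨a, ha⟩ := hM.pairing x.1 t
  have hay : a ∈ₘ F y := hxy ▸ (hF x a).2 (.inr ha)
  rcases (hF y a).1 hay with ⟨u, -, hu⟩ | ha'
  · exact (hF.ne_tag hM ht hB hGB x.2 ha u hu).elim
  · exact Subtype.ext (ha.swap.right_inj ha'.swap)

theorem isComponentEmbedding : G.toGraph.IsComponentEmbedding (dGraph M) F := by
  refine ⟨hF.injective hM ht hB hGB, fun x w => ⟨fun ⟨hxw, hwx⟩ => ?_, ?_⟩⟩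
  · exact ((hF x w).1 hwx).resolve_right fun hw => hF.not_mem_tag hM ht hB hGB x.2 hw x hxw
  · rintro ⟨y, hxy, rfl⟩
    exact ⟨(hF y _).2 (.inl ⟨x, G.toGraph.symm _ _ hxy, rfl⟩), (hF x _).2 (.inl ⟨y, hxy, rfl⟩)⟩

end IsTaggedSolution

namespace IsZFMinusModel

variable (hM : IsZFMinusModel M) (hAFA : SatisfiesAFA₁ M) (G : InternalGraph M)
include hM hAFA

theorem exists_isComponentEmbedding_dGraph {B : M} (hB : IsTransitive B)
    (hGB : ∀ x, x ∈ₘ G.dom → x ∈ₘ B) :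
    ∃ F, G.toGraph.IsComponentEmbedding (dGraph M) F ∧ ∀ x, ¬ F x ∈ₘ B := by
  obtain ⟨t, ht⟩ := hM.exists_isFresh B
  obtain ⟨F, hF⟩ := hM.exists_isTaggedSolution hAFA G (t := t)
    fun x z _ hz hzG => ht.tag_not_mem hB hz (hGB z hzG)
  exact ⟨F, hF.isComponentEmbedding hM ht hB hGB, hF.not_mem hM ht hB⟩

variable {C' : Set {x : M // x ∈ₘ G.dom}} (hC' : G.toGraph.IsComponent C')
include hC'

theorem exists_component_isIso_disjoint {s : Set M} (hs : s.Finite) :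
    ∃ C, (dGraph M).IsComponent C ∧ ((dGraph M).induce C).IsIso (G.toGraph.induce C') ∧
      Disjoint C s := by
  obtain ⟨v, rfl⟩ := hC'
  obtain ⟨b, hb⟩ := hM.exists_mem_of_finite (hs.insert G.dom)
  obtain ⟨B, hbB, hB⟩ := hM.exists_isTransitive_mem b
  have hsB : ∀ x ∈ insert G.dom s, x ∈ₘ B := fun x hx => hB b hbB x (hb x hx)
  obtain ⟨F, hF, hF_not_mem⟩ := hM.exists_isComponentEmbedding_dGraph hAFA G hB
    (hB G.dom (hsB _ (Set.mem_insert _ _)))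
  refine ⟨_, ⟨F v, rfl⟩, hF.induce_component_isIso v, Set.disjoint_left.2 fun x hx hxs => ?_⟩
  rw [hF.component_map] at hx
  obtain ⟨y, -, rfl⟩ := hx
  exact hF_not_mem y (hsB _ (Set.mem_insert_of_mem _ hxs))

theorem infinite_setOf_component_isIso :
    {C | (dGraph M).IsComponent C ∧
      ((dGraph M).induce C).IsIso (G.toGraph.induce C')}.Infinite := by
  intro hfin
  have : Nonempty M := hM.infinity.nonempty
  choose! v hv using fun (C : Set M) (hC : (dGraph M).IsComponent C) => hC.nonempty
  obtain ⟨C, hC, hiso, hdisj⟩ :=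
    hM.exists_component_isIso_disjoint hAFA G hC' (hfin.image v)
  exact Set.disjoint_left.1 hdisj (hv C hC) ⟨C, ⟨hC, hiso⟩, rfl⟩

end IsZFMinusModel

end ZFA

theorem mainTheorem5_general {M : Type*} [ZFA.setLang.Structure M] (hM : ZFA.IsZFMinusModel M)
    (hAFA : ZFA.SatisfiesAFA₁ M) :
    (∀ C : Set M, (ZFA.dGraph M).IsComponent C →
      ∃ (G : ZFA.InternalGraph M) (C' : Set {x : M // ZFA.Mem x G.dom}),
        G.toGraph.IsComponent C' ∧ ((ZFA.dGraph M).induce C).IsIso (G.toGraph.induce C')) ∧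
    (∀ (G : ZFA.InternalGraph M) (C' : Set {x : M // ZFA.Mem x G.dom}),
      G.toGraph.IsComponent C' →
        ∃ C : Set M, (ZFA.dGraph M).IsComponent C ∧
          ((ZFA.dGraph M).induce C).IsIso (G.toGraph.induce C')) ∧
    (∀ C : Set M, (ZFA.dGraph M).IsComponent C →
      {C₁ : Set M | (ZFA.dGraph M).IsComponent C₁ ∧
        ((ZFA.dGraph M).induce C).IsIso ((ZFA.dGraph M).induce C₁)}.Infinite) := by
  refine ⟨fun C => hM.exists_internalGraph_component_isIso, fun G C' hC' =>
    (hM.infinite_setOf_component_isIso hAFA G hC').nonempty, fun C hC => ?_⟩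
  obtain ⟨G, C', hC', hiso⟩ := hM.exists_internalGraph_component_isIso hC
  exact (hM.infinite_setOf_component_isIso hAFA G hC').mono
    fun C₁ hC₁ => ⟨hC₁.1, hiso.trans hC₁.2.symm⟩

theorem mainTheorem5 {M : Type*} [ZFA.setLang.Structure M] (hM : ZFA.IsModel M) :
    (∀ C : Set M, (ZFA.dGraph M).IsComponent C →
      ∃ (G : ZFA.InternalGraph M) (C' : Set {x : M // ZFA.Mem x G.dom}),
        G.toGraph.IsComponent C' ∧ ((ZFA.dGraph M).induce C).IsIso (G.toGraph.induce C')) ∧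
    (∀ (G : ZFA.InternalGraph M) (C' : Set {x : M // ZFA.Mem x G.dom}),
      G.toGraph.IsComponent C' →
        ∃ C : Set M, (ZFA.dGraph M).IsComponent C ∧
          ((ZFA.dGraph M).induce C).IsIso (G.toGraph.induce C')) ∧
    (∀ C : Set M, (ZFA.dGraph M).IsComponent C →
      {C₁ : Set M | (ZFA.dGraph M).IsComponent C₁ ∧
        ((ZFA.dGraph M).induce C).IsIso ((ZFA.dGraph M).induce C₁)}.Infinite) :=
  mainTheorem5_general hM.isZFMinusModel hM.satisfiesAFA₁
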